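/- Let $P\subset\mathbb R^d$ be a full-dimensional convex polytope. A plane is a $2$-dimensional linear subspace $W$ of $\mathbb R^d$; $\pi_W:\mathbb R^d\to W$ denotes the orthogonal projection on $W$. A $2$-face of $P$ is a $2$-dimensional face of $P$. Consider two notions of admissibility of a plane $W$ for $P$: 1. no $2$-face $F$ of $P$ is sent into the boundary of the projection, that is, $\pi_W(F)\not\subseteq\partial(\pi_W(P))$ for every $2$-face $F$, the boundary being taken in $W$; 2. no $2$-face $F$ of $P$ is sent onto a segment anywhere in the projection, that is, for every $2$-face $F$ the image $\pi_W(F)$ is not a segment (a single point being considered as a segment). For either notion and $k\in\mathbb N$, call $P$ $k$-equiprojective if $\pi_W(P)$ is a $k$-gon (a convex polygon with exactly $k$ vertices) for every plane $W$ admissible for $P$, and call $P$ equiprojective if it is $k$-equiprojective for some $k$. Then both notions of admissibility yield the same notion of equiprojectivity: for every $k\in\mathbb N$, $P$ is $k$-equiprojective with respect to (1) if and only if it is $k$-equiprojective with respect to (2); in particular $P$ is equiprojective with respect to (1) if and only if it is equiprojective with respect to (2). -/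

import Mathlib

open Module

/-- A convex polytope: the convex hull of finitely many points. -/
def IsPolytope {E : Type*} [AddCommGroup E] [Module ℝ E] (P : Set E) : Prop :=
  ∃ s : Set E, s.Finite ∧ P = convexHull ℝ s

/-- `F` is a two-dimensional face of `P`: a subset of `P` on which some linear functional attains
its maximum over `P` (the zero functional gives `P` itself), with two-dimensional affine hull. -/
def IsTwoFace {d : ℕ} (P F : Set (EuclideanSpace ℝ (Fin d))) : Prop :=
  IsExposed ℝ P F ∧ finrank ℝ (vectorSpan ℝ F) = 2

/-- The image `π_W(P)` of `P` by the orthogonal projection on `W`, as a subset of the space `W`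
(so that its topological boundary is the boundary relative to `W`). -/
def projOn {d : ℕ} (W : Submodule ℝ (EuclideanSpace ℝ (Fin d)))
    (P : Set (EuclideanSpace ℝ (Fin d))) : Set W :=
  W.orthogonalProjectionOnto '' P

/-- A convex polygon with `k` vertices in the plane `W`. -/
def IsKGon {d : ℕ} {W : Submodule ℝ (EuclideanSpace ℝ (Fin d))} (k : ℕ) (S : Set W) : Prop :=
  IsPolytope S ∧ (interior S).Nonempty ∧ (S.extremePoints ℝ).encard = k

/-- `W` is a plane for which no 2-face of `P` is sent into the boundary of the projection. -/
def BoundaryAdmissible {d : ℕ} (P : Set (EuclideanSpace ℝ (Fin d)))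
    (W : Submodule ℝ (EuclideanSpace ℝ (Fin d))) : Prop :=
  finrank ℝ W = 2 ∧ ∀ F, IsTwoFace P F → ¬ projOn W F ⊆ frontier (projOn W P)

/-- `W` is a plane for which no 2-face of `P` is sent onto a segment, wherever it lies in the
projection; a segment may be reduced to a point. -/
def SegmentAdmissible {d : ℕ} (P : Set (EuclideanSpace ℝ (Fin d)))
    (W : Submodule ℝ (EuclideanSpace ℝ (Fin d))) : Prop :=
  finrank ℝ W = 2 ∧ ∀ F, IsTwoFace P F → ¬ ∃ a b : W, projOn W F = segment ℝ a b

/-- `P` is `k`-equiprojective with respect to a notion `Adm` of admissible planes for `P`: every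
projection of `P` on an admissible plane is a `k`-gon. -/
def IsKEquiprojective {d : ℕ}
    (Adm : Set (EuclideanSpace ℝ (Fin d)) → Submodule ℝ (EuclideanSpace ℝ (Fin d)) → Prop)
    (k : ℕ) (P : Set (EuclideanSpace ℝ (Fin d))) : Prop :=
  ∀ W, Adm P W → IsKGon k (projOn W P)

/-- `P` is equiprojective with respect to a notion `Adm` of admissible planes for `P`. -/
def IsEquiprojective {d : ℕ}
    (Adm : Set (EuclideanSpace ℝ (Fin d)) → Submodule ℝ (EuclideanSpace ℝ (Fin d)) → Prop)
    (P : Set (EuclideanSpace ℝ (Fin d))) : Prop :=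
  ∃ k : ℕ, IsKEquiprojective Adm k P

/-!
Let `V` be the set of vertices of `P` and `π` the orthogonal projection on a plane `W`.

If `W` is admissible for the segment notion, it is admissible for the boundary notion: a convex
subset of the boundary of the polygon `π(P)` lies on one supporting line, so it is a segment
(`SegmentAdmissible.boundaryAdmissible`).

Conversely, let `W` be admissible for the boundary notion only. A nonzero functional represented by
a vector of `W` exposes a face of `P` that is sent into the boundary of `π(P)`. As every face of
dimension at least `2` contains a `2`-face (`exists_argmaxSet_subset_finrank_eq_two`), such a face is
a vertex or an edge. Hence a vertex of `P` either is the unique maximum of a functional of `W`, and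
projects to a vertex of `π(P)`, or is sent to the interior of `π(P)`
(`isStrictlyExposedIn_or_isInnerIn`); the vertices of `π(P)` correspond bijectively to the points
of `V` of the first kind (`encard_extremePoints_projOn`). Both conditions are open in `W`
(`IsStrictlyExposedIn.eventually`, `IsInnerIn.eventually`), while the planes on which the
projection is injective on the direction of each `2`-face are dense
(`exists_mem_nhds_forall_injOn`). So there is a plane close to `W` which is admissible for the
segment notion and on which the projection of `P` has as many vertices as `π(P)`
(`BoundaryAdmissible.exists_segmentAdmissible`).
-/

/-! ### Faces of a finite point set -/

section ArgmaxSet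

variable {E : Type*} [NormedAddCommGroup E] [InnerProductSpace ℝ E]

/-- The points of `V` at which the functional `⟪l, ·⟫` attains its maximum over `V`. -/
def argmaxSet (V : Set E) (l : E) : Set E :=
  {p ∈ V | ∀ v ∈ V, inner ℝ l v ≤ inner ℝ l p}

theorem argmaxSet_subset (V : Set E) (l : E) : argmaxSet V l ⊆ V := fun _ h => h.1

theorem argmaxSet_nonempty {V : Set E} (hV : V.Finite) (hne : V.Nonempty) (l : E) :
    (argmaxSet V l).Nonempty := by
  obtain ⟨p, hp, h⟩ := Set.exists_max_image V (fun v => inner ℝ l v) hV hne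
  exact ⟨p, hp, h⟩

theorem inner_eq_of_mem_argmaxSet {V : Set E} {l p q : E} (hp : p ∈ argmaxSet V l)
    (hq : q ∈ argmaxSet V l) : inner ℝ l p = inner ℝ l q :=
  le_antisymm (hq.2 p hp.1) (hp.2 q hq.1)

theorem inner_eq_zero_of_mem_vectorSpan {A : Set E} {l : E}
    (h : ∀ p ∈ A, ∀ q ∈ A, inner ℝ l p = inner ℝ l q) {x : E} (hx : x ∈ vectorSpan ℝ A) :
    inner ℝ l x = 0 := by
  have hle : vectorSpan ℝ A ≤ LinearMap.ker (innerSL ℝ l : E →ₗ[ℝ] ℝ) := by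
    rw [vectorSpan_def, Submodule.span_le]
    rintro _ ⟨p, hp, q, hq, rfl⟩
    simp [inner_sub_right, h p hp q hq]
  simpa using hle hx

/-- A small tilt of `l` in the direction `m` cuts out, from the face of `l`, the face of `m`: faces
of faces are faces. -/
theorem exists_argmaxSet_add_smul_eq {V : Set E} (hV : V.Finite) (l m : E) :
    ∃ ε : ℝ, argmaxSet V (l + ε • m) = argmaxSet (argmaxSet V l) m := by
  rcases V.eq_empty_or_nonempty with rfl | hne
  · exact ⟨0, by simp [argmaxSet]⟩
  have hA : (argmaxSet V l).Finite := hV.subset (argmaxSet_subset V l)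
  have key : ∀ᶠ ε : ℝ in nhdsWithin 0 (Set.Ioi 0), ∀ p ∈ argmaxSet V l, ∀ v ∈ V,
      v ∉ argmaxSet V l → inner ℝ (l + ε • m) v < inner ℝ (l + ε • m) p := by
    refine (Filter.eventually_all_finite hA).2 fun p hp => (Filter.eventually_all_finite hV).2
      fun v hv => ?_
    by_cases hvA : v ∈ argmaxSet V l
    · exact Filter.Eventually.of_forall fun _ h => absurd hvA h
    have hlt : inner ℝ l v < inner ℝ l p := by
      refine lt_of_le_of_ne (hp.2 v hv) fun he => hvA ⟨hv, fun u hu => ?_⟩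
      rw [he]; exact hp.2 u hu
    have hc : ∀ x : E, Continuous fun ε : ℝ => (inner ℝ (l + ε • m) x : ℝ) := fun x => by fun_prop
    have := (hc v).continuousAt (x := 0) |>.eventually_lt (hc p).continuousAt (by simpa using hlt)
    filter_upwards [nhdsWithin_le_nhds this] with ε hε _ using hε
  obtain ⟨ε, hε, hpos⟩ := (key.and self_mem_nhdsWithin).exists
  have hpos : 0 < ε := hpos
  obtain ⟨p, hp⟩ := argmaxSet_nonempty hV hne l
  refine ⟨ε, Set.Subset.antisymm (fun x hx => ?_) fun x hx => ⟨hx.1.1, fun v hv => ?_⟩⟩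
  · have hxA : x ∈ argmaxSet V l := by
      by_contra h
      exact absurd (hx.2 p hp.1) (not_le.2 (hε p hp x hx.1 h))
    refine ⟨hxA, fun y hy => ?_⟩
    have h1 := hx.2 y hy.1
    simp only [inner_add_left, real_inner_smul_left, inner_eq_of_mem_argmaxSet hy hxA] at h1
    exact le_of_mul_le_mul_left (by linarith) hpos
  · by_cases hvA : v ∈ argmaxSet V l
    · have h1 := hx.2 v hvA
      simp only [inner_add_left, real_inner_smul_left, inner_eq_of_mem_argmaxSet hvA hx.1]
      nlinarith
    · exact (hε x hx.1 v hv hvA).le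

/-- Rotating a supporting hyperplane around one of its faces until it meets a further point: if `m`
is constant on the face of `l`, but not on all of `V`, the face of some `l + t • m` is strictly
larger than that of `l`. -/
theorem exists_argmaxSet_ssubset {V : Set E} (hV : V.Finite) {l m p q : E}
    (hconst : ∀ x ∈ argmaxSet V l, inner ℝ m x = inner ℝ m p) (hp : p ∈ argmaxSet V l)
    (hq : q ∈ V) (hmq : inner ℝ m q ≠ inner ℝ m p) :
    ∃ t : ℝ, argmaxSet V l ⊂ argmaxSet V (l + t • m) := by
  wlog hlt : inner ℝ m p < inner ℝ m q generalizing m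
  · obtain ⟨t, ht⟩ := this (m := -m) (by simpa using hconst) (by simpa using hmq)
      (by simpa using lt_of_le_of_ne (not_lt.1 hlt) hmq)
    exact ⟨-t, by simpa using ht⟩
  -- The hyperplane meets the point `v` at time `f v`; the first such time is the wanted `t`.
  let f : E → ℝ := fun v => (inner ℝ l p - inner ℝ l v) / (inner ℝ m v - inner ℝ m p)
  obtain ⟨v₀, ⟨hv₀, hmv₀⟩, hmin⟩ := Set.exists_min_image {v ∈ V | inner ℝ m p < inner ℝ m v} f
    (hV.subset fun _ h => h.1) ⟨q, hq, hlt⟩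
  have hf₀ : 0 ≤ f v₀ := div_nonneg (sub_nonneg.2 (hp.2 v₀ hv₀)) (sub_pos.2 hmv₀).le
  have hsupp : ∀ v ∈ V, inner ℝ (l + f v₀ • m) v ≤ inner ℝ (l + f v₀ • m) p := by
    intro v hv
    simp only [inner_add_left, real_inner_smul_left]
    have hlv := hp.2 v hv
    rcases le_or_gt (inner ℝ m v) (inner ℝ m p) with h | h
    · nlinarith
    · have := hmin v ⟨hv, h⟩
      have h2 : f v₀ * (inner ℝ m v - inner ℝ m p) ≤ inner ℝ l p - inner ℝ l v :=
        (le_div_iff₀ (sub_pos.2 h)).1 this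
      linarith
  have hval₀ : inner ℝ (l + f v₀ • m) v₀ = inner ℝ (l + f v₀ • m) p := by
    have : f v₀ * (inner ℝ m v₀ - inner ℝ m p) = inner ℝ l p - inner ℝ l v₀ :=
      div_mul_cancel₀ _ (sub_pos.2 hmv₀).ne'
    simp only [inner_add_left, real_inner_smul_left]
    linarith
  refine ⟨f v₀, fun x hx => ⟨hx.1, fun v hv => ?_⟩, fun hsub => ?_⟩
  · have : inner ℝ (l + f v₀ • m) x = inner ℝ (l + f v₀ • m) p := by
      simp only [inner_add_left, real_inner_smul_left, hconst x hx, inner_eq_of_mem_argmaxSet hx hp]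
    rw [this]; exact hsupp v hv
  · exact hmv₀.ne' (hconst v₀ (hsub ⟨hv₀, fun v hv => hval₀ ▸ hsupp v hv⟩))

/-- Adding to a subset of a face of `V` a point of `V` off that face enlarges its direction. -/
theorem vectorSpan_lt_of_ssubset_argmaxSet {V : Set E} {l p q : E} {A : Set E}
    (hA : A ⊆ argmaxSet V l) (hp : p ∈ A) (hq : q ∈ V) (hq' : q ∉ argmaxSet V l) {B : Set E}
    (hAB : A ⊆ B) (hqB : q ∈ B) : vectorSpan ℝ A < vectorSpan ℝ B := by
  refine lt_of_le_of_ne (vectorSpan_mono ℝ hAB) fun he => hq' ⟨hq, fun v hv => ?_⟩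
  have hmem : q -ᵥ p ∈ vectorSpan ℝ A := he ▸ vsub_mem_vectorSpan ℝ hqB (hAB hp)
  have := inner_eq_zero_of_mem_vectorSpan
    (fun x hx y hy => inner_eq_of_mem_argmaxSet (hA hx) (hA hy)) hmem
  rw [vsub_eq_sub, inner_sub_right, sub_eq_zero] at this
  rw [this]; exact (hA hp).2 v hv

/-- Every face of dimension at least `2` contains a `2`-dimensional one. A proper face of largest
cardinality of a face of dimension `n ≥ 3` has dimension at least `2`: otherwise there is room
to rotate its supporting hyperplane and reach a larger proper face. -/
theorem exists_argmaxSet_subset_finrank_eq_two [FiniteDimensional ℝ E] {V : Set E} (hV : V.Finite)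
    (l : E) (hl : 2 ≤ finrank ℝ (vectorSpan ℝ (argmaxSet V l))) :
    ∃ m : E, argmaxSet V m ⊆ argmaxSet V l ∧ finrank ℝ (vectorSpan ℝ (argmaxSet V m)) = 2 := by
  induction hn : finrank ℝ (vectorSpan ℝ (argmaxSet V l)) using Nat.strong_induction_on
    generalizing l with
  | _ n ih =>
  subst hn
  rcases hl.eq_or_lt with h2 | h3
  · exact ⟨l, subset_rfl, h2.symm⟩
  set A := argmaxSet V l with hAdef
  have hAfin : A.Finite := hV.subset (argmaxSet_subset V l)
  have hAne : A.Nonempty := by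
    rw [Set.nonempty_iff_ne_empty]
    intro h
    rw [h, vectorSpan_empty, finrank_bot] at h3
    omega
  have hproper : ∀ m : E, ∀ y ∈ vectorSpan ℝ A, inner ℝ m y ≠ 0 → argmaxSet A m ≠ A := by
    intro m y hy hmy he
    refine hmy (inner_eq_zero_of_mem_vectorSpan (fun p hp q hq => ?_) hy)
    rw [← he] at hp hq
    exact inner_eq_of_mem_argmaxSet hp hq
  have hpos : 0 < finrank ℝ (vectorSpan ℝ A) := by omega
  obtain ⟨y₀, hy₀, hy₀ne⟩ := (Submodule.ne_bot_iff _).1 (Submodule.one_le_finrank_iff.1 hpos)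
  obtain ⟨B, ⟨⟨m, rfl⟩, hBA⟩, hmax⟩ := Set.exists_max_image
    {B : Set E | (∃ m, B = argmaxSet A m) ∧ B ≠ A} Set.ncard
    (hAfin.finite_subsets.subset (by rintro _ ⟨⟨m, rfl⟩, -⟩; exact argmaxSet_subset A m))
    ⟨_, ⟨y₀, rfl⟩, hproper y₀ y₀ hy₀ (by simpa using hy₀ne)⟩
  obtain ⟨p, hp⟩ := argmaxSet_nonempty hAfin hAne m
  obtain ⟨q, hq, hqB⟩ := Set.exists_of_ssubset ((argmaxSet_subset A m).ssubset_of_ne hBA)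
  have hlt := vectorSpan_lt_of_ssubset_argmaxSet subset_rfl hp hq hqB (argmaxSet_subset A m) hq
  by_cases hB : 2 ≤ finrank ℝ (vectorSpan ℝ (argmaxSet A m))
  · obtain ⟨ε, hε⟩ := exists_argmaxSet_add_smul_eq hV l m
    obtain ⟨m', hm', h2⟩ := ih _ (Submodule.finrank_lt_finrank_of_lt hlt) (l + ε • m)
      (by rw [hε]; exact hB) (by rw [hε])
    exact ⟨m', hm'.trans (hε ▸ argmaxSet_subset A m), h2⟩
  · exfalso
    -- `m'` vanishes on the direction of the face of `m` and on `y`, where `m` does not.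
    set y := q - p
    have hy : y ∈ vectorSpan ℝ A := vsub_mem_vectorSpan ℝ hq (argmaxSet_subset A m hp)
    have hmy : inner ℝ m y ≠ 0 := by
      intro h
      rw [inner_sub_right, sub_eq_zero] at h
      exact hqB ⟨hq, fun v hv => h ▸ hp.2 v hv⟩
    set K := vectorSpan ℝ (argmaxSet A m) ⊔ Submodule.span ℝ {y} with hK
    have hKlt : finrank ℝ K < finrank ℝ (vectorSpan ℝ A) := by
      have h1 := Submodule.finrank_add_le_finrank_add_finrank (vectorSpan ℝ (argmaxSet A m))
        (Submodule.span ℝ {y})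
      have h2 := finrank_span_singleton (K := ℝ) (v := y) (by rintro h; simp [h] at hmy)
      rw [hK]
      omega
    obtain ⟨x, hx, hxK⟩ : ∃ x ∈ vectorSpan ℝ A, x ∉ K := by
      by_contra! h
      exact absurd (Submodule.finrank_mono (fun x hx => h x hx : vectorSpan ℝ A ≤ K))
        (not_le.2 hKlt)
    obtain ⟨m', hm'K, hm'x⟩ : ∃ m' ∈ Kᗮ, inner ℝ m' x ≠ 0 := by
      rw [← K.orthogonal_orthogonal, Submodule.mem_orthogonal] at hxK
      push Not at hxK
      exact hxK
    have hm'B : ∀ z ∈ vectorSpan ℝ (argmaxSet A m), inner ℝ m' z = 0 := fun z hz =>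
      (Submodule.mem_orthogonal' K m').1 hm'K z (Submodule.mem_sup_left hz)
    have hm'y : inner ℝ m' y = 0 := (Submodule.mem_orthogonal' K m').1 hm'K y
      (Submodule.mem_sup_right (Submodule.mem_span_singleton_self y))
    obtain ⟨r, hr, hmr⟩ : ∃ r ∈ A, inner ℝ m' r ≠ inner ℝ m' p := by
      by_contra! h
      exact hm'x (inner_eq_zero_of_mem_vectorSpan (fun a ha b hb => (h a ha).trans (h b hb).symm) hx)
    obtain ⟨t, ht⟩ := exists_argmaxSet_ssubset hAfin (l := m) (m := m') (p := p) (q := r)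
      (fun z hz => by
        have := hm'B (z -ᵥ p) (vsub_mem_vectorSpan ℝ hz hp)
        rwa [vsub_eq_sub, inner_sub_right, sub_eq_zero] at this) hp hr hmr
    have hne : argmaxSet A (m + t • m') ≠ A := hproper _ y hy (by
      simpa [inner_add_left, real_inner_smul_left, hm'y] using hmy)
    exact absurd (hmax _ ⟨⟨_, rfl⟩, hne⟩) (not_le.2 (Set.ncard_lt_ncard ht
      (hAfin.subset (argmaxSet_subset _ _))))

end ArgmaxSet

/-! ### Supporting functionals and exposed faces -/

section Support

variable {E : Type*} [NormedAddCommGroup E] [InnerProductSpace ℝ E]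

theorem inner_le_of_mem_convexHull {V : Set E} {l x : E} {c : ℝ} (h : ∀ v ∈ V, inner ℝ l v ≤ c)
    (hx : x ∈ convexHull ℝ V) : inner ℝ l x ≤ c :=
  convexHull_min (t := {x | inner ℝ l x ≤ c}) h
    (convex_halfSpace_le (innerSL ℝ l).toLinearMap.isLinear c) hx

/-- A convex subset of a convex body `S` that avoids the interior of `S` lies in a proper face
of `S`. -/
theorem Convex.exists_inner_le_of_disjoint_interior [CompleteSpace E] {S T : Set E}
    (hS : Convex ℝ S) (hSi : (interior S).Nonempty) (hT : Convex ℝ T) (hTne : T.Nonempty)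
    (hST : Disjoint (interior S) T) :
    ∃ w : E, w ≠ 0 ∧ ∀ x ∈ S, ∀ y ∈ T, inner ℝ w x ≤ inner ℝ w y := by
  obtain ⟨f, u, hf, hu⟩ := geometric_hahn_banach_open hS.interior isOpen_interior hT hST
  obtain ⟨w, rfl⟩ := (InnerProductSpace.toDual ℝ E).surjective f
  simp only [InnerProductSpace.toDual_apply_apply] at hf hu
  refine ⟨w, ?_, fun x hx y hy => le_trans ?_ (hu y hy)⟩
  · rintro rfl
    obtain ⟨a, ha⟩ := hSi
    obtain ⟨b, hb⟩ := hTne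
    have h1 := hf a ha
    have h2 := hu b hb
    simp only [inner_zero_left] at h1 h2
    linarith
  · have hcl : closure (interior S) ⊆ {x | inner ℝ w x ≤ u} :=
      closure_minimal (fun a ha => (hf a ha).le) (isClosed_le (by fun_prop) continuous_const)
    rw [hS.closure_interior_eq_closure_of_nonempty_interior hSi] at hcl
    exact hcl (subset_closure hx)

theorem mem_frontier_of_forall_inner_le {S : Set E} {w y : E} (hw : w ≠ 0) (hy : y ∈ S)
    (h : ∀ x ∈ S, inner ℝ w x ≤ inner ℝ w y) : y ∈ frontier S := by
  refine ⟨subset_closure hy, fun hyi => ?_⟩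
  have hc : ContinuousAt (fun t : ℝ => y + t • w) 0 := by fun_prop
  have hev : ∀ᶠ t : ℝ in nhdsWithin 0 (Set.Ioi 0), y + t • w ∈ S := nhdsWithin_le_nhds
    (hc.eventually_mem (by simpa using mem_interior_iff_mem_nhds.1 hyi))
  obtain ⟨t, ht, hpos⟩ := (hev.and self_mem_nhdsWithin).exists
  have hpos : 0 < t := hpos
  have := h _ ht
  rw [inner_add_right, real_inner_smul_right] at this
  have h2 : 0 < inner ℝ w w := real_inner_self_pos.2 hw
  nlinarith

theorem vectorSpan_convexHull (A : Set E) : vectorSpan ℝ (convexHull ℝ A) = vectorSpan ℝ A := by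
  rw [← direction_affineSpan, affineSpan_convexHull, direction_affineSpan]

/-- A face of a polytope is the convex hull of the generators it contains, by the Krein-Milman
theorem. -/
theorem IsExposed.eq_convexHull_inter {V F : Set E} (hV : V.Finite)
    (hF : IsExposed ℝ (convexHull ℝ V) F) : F = convexHull ℝ (F ∩ V) := by
  have hFc : IsCompact F := hF.isCompact (hV.isCompact_convexHull ℝ)
  have hFconv : Convex ℝ F := hF.convex (convex_convexHull ℝ V)
  refine Set.Subset.antisymm ?_ (convexHull_min Set.inter_subset_left hFconv)
  refine (closure_convexHull_extremePoints hFc hFconv).symm.subset.trans ?_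
  refine closure_minimal (convexHull_mono fun x hx => ⟨extremePoints_subset hx, ?_⟩)
    ((hV.subset Set.inter_subset_right).isCompact_convexHull ℝ).isClosed
  exact extremePoints_convexHull_subset (hF.isExtreme.extremePoints_subset_extremePoints hx)

theorem toExposed_convexHull {V : Set E} (hV : V.Finite) (l : E) :
    (innerSL ℝ l).toExposed (convexHull ℝ V) = convexHull ℝ (argmaxSet V l) := by
  rw [ContinuousLinearMap.toExposed.isExposed.eq_convexHull_inter hV]
  congr 1
  ext x
  constructor
  · rintro ⟨⟨-, hx⟩, hxV⟩
    exact ⟨hxV, fun v hv => hx v (subset_convexHull ℝ V hv)⟩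
  · rintro ⟨hxV, hx⟩
    exact ⟨⟨subset_convexHull ℝ V hxV, fun y hy => inner_le_of_mem_convexHull hx hy⟩, hxV⟩

end Support

/-! ### Points seen as vertices or as inner points of the projection -/

section Dichotomy

variable {E : Type*} [NormedAddCommGroup E] [InnerProductSpace ℝ E]

/-- Some functional represented by a vector of `W` has `p` as its only maximum over `V`. For
`p ∈ V`, this says that `p` is the only point of the convex hull of `V` that the orthogonal
projection on `W` sends to the image of `p`, and that this image is a vertex. -/
def IsStrictlyExposedIn (W : Submodule ℝ E) (V : Set E) (p : E) : Prop :=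
  ∃ w ∈ W, ∀ v ∈ V, v ≠ p → inner ℝ w v < inner ℝ w p

/-- No nonzero functional represented by a vector of `W` has a maximum over `V` at `p`. This says
that the orthogonal projection on `W` sends `p` to an interior point of the image of the convex hull
of `V`. -/
def IsInnerIn (W : Submodule ℝ E) (V : Set E) (p : E) : Prop :=
  ∀ w ∈ W, w ≠ 0 → ∃ v ∈ V, inner ℝ w p < inner ℝ w v

theorem IsInnerIn.not_isStrictlyExposedIn {W : Submodule ℝ E} {V : Set E} {p : E} (hW : W ≠ ⊥)
    (h : IsInnerIn W V p) : ¬ IsStrictlyExposedIn W V p := by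
  rintro ⟨w, hw, hwp⟩
  have key : ∀ u ∈ W, u ≠ 0 → ∃ v ∈ V, v ≠ p := fun u hu hu0 => by
    obtain ⟨v, hv, hlt⟩ := h u hu hu0
    exact ⟨v, hv, by rintro rfl; exact lt_irrefl _ hlt⟩
  by_cases hw0 : w = 0
  · obtain ⟨u, hu, hu0⟩ := (Submodule.ne_bot_iff W).1 hW
    obtain ⟨v, hv, hne⟩ := key u hu hu0
    simpa [hw0] using hwp v hv hne
  · obtain ⟨v, hv, hlt⟩ := h w hw hw0
    exact lt_asymm hlt (hwp v hv (by rintro rfl; exact lt_irrefl _ hlt))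

/-- If the faces of `V` in the directions of the plane `W` are at most edges, a vertex supported in
such a direction is strictly exposed: on an edge `[p, q]` that `W` does not contract, tilt the
functional away from `q`; an edge contracted by `W` cannot occur, because rotating its supporting
hyperplane within `W` would produce a face of dimension at least `2`. -/
theorem isStrictlyExposedIn_or_isInnerIn {W : Submodule ℝ E} {V : Set E} {p : E}
    (hV : V.Finite) (hW : finrank ℝ W = 2) (hspan : vectorSpan ℝ V = ⊤)
    [FiniteDimensional ℝ E]
    (hface : ∀ w ∈ W, w ≠ 0 → finrank ℝ (vectorSpan ℝ (argmaxSet V w)) < 2)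
    (hp : p ∈ (convexHull ℝ V).extremePoints ℝ) :
    IsStrictlyExposedIn W V p ∨ IsInnerIn W V p := by
  by_cases hin : IsInnerIn W V p
  · exact Or.inr hin
  left
  have hpV : p ∈ V := extremePoints_convexHull_subset hp
  simp only [IsInnerIn] at hin
  push Not at hin
  obtain ⟨w, hw, hw0, hwp⟩ := hin
  have hpA : p ∈ argmaxSet V w := ⟨hpV, hwp⟩
  have strict : ∀ l ∈ W, argmaxSet V l ⊆ {p} → p ∈ argmaxSet V l →
      IsStrictlyExposedIn W V p := by
    refine fun l hl hsub hpl => ⟨l, hl, fun v hv hne => lt_of_le_of_ne (hpl.2 v hv) fun he => ?_⟩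
    exact hne (hsub ⟨hv, fun u hu => he ▸ hpl.2 u hu⟩)
  by_cases hq : argmaxSet V w ⊆ {p}
  · exact strict w hw hq hpA
  obtain ⟨q, hqA, hqp⟩ := Set.not_subset.1 hq
  have hqp0 : q - p ≠ 0 := sub_ne_zero.2 hqp
  have hmem : q - p ∈ vectorSpan ℝ (argmaxSet V w) := vsub_mem_vectorSpan ℝ hqA hpA
  have hpos : 1 ≤ finrank ℝ (vectorSpan ℝ (argmaxSet V w)) :=
    Submodule.one_le_finrank_iff.2 ((Submodule.ne_bot_iff _).2 ⟨_, hmem, hqp0⟩)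
  have hone : finrank ℝ (vectorSpan ℝ (argmaxSet V w)) = 1 := by
    have := hface w hw hw0
    omega
  have hline : ∀ v ∈ argmaxSet V w, ∃ c : ℝ, v = p + c • (q - p) := by
    intro v hv
    obtain ⟨c, hc⟩ := (finrank_eq_one_iff_of_nonzero'
      (⟨q - p, hmem⟩ : vectorSpan ℝ (argmaxSet V w)) (by simpa using hqp0)).1 hone
      ⟨v - p, vsub_mem_vectorSpan ℝ hv hpA⟩
    have : c • (q - p) = v - p := congrArg Subtype.val hc
    exact ⟨c, by rw [this]; abel⟩
  by_cases hu : ∃ u ∈ W, inner ℝ u (q - p) < 0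
  · obtain ⟨u, huW, hu⟩ := hu
    obtain ⟨ε, hε⟩ := exists_argmaxSet_add_smul_eq hV w u
    -- The vertex `p` is an end of the edge, so the face lies on the ray from `p` through `q`.
    have hnonneg : ∀ c : ℝ, p + c • (q - p) ∈ V → 0 ≤ c := by
      intro c hc
      by_contra! hneg
      have h1c : (1 : ℝ) - c ≠ 0 := by linarith
      have hseg : p ∈ openSegment ℝ (p + c • (q - p)) q := by
        refine ⟨1 / (1 - c), -c / (1 - c), by apply div_pos <;> linarith,
          by apply div_pos <;> linarith, by field_simp; ring, ?_⟩
        have e : (1 / (1 - c)) • (p + c • (q - p)) + (-c / (1 - c)) • q =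
            ((1 / (1 - c)) * (1 - c)) • p + (c / (1 - c) + -c / (1 - c)) • q := by
          module
        rw [e, one_div_mul_cancel h1c, ← add_div, add_neg_cancel, zero_div, zero_smul, one_smul,
          add_zero]
      exact hqp ((mem_extremePoints.1 hp).2 _ (subset_convexHull ℝ V hc) _
        (subset_convexHull ℝ V hqA.1) hseg).2
    refine strict (w + ε • u) (W.add_mem hw (W.smul_mem ε huW)) ?_ ?_
    · rw [hε]
      intro v hv
      obtain ⟨c, rfl⟩ := hline v hv.1
      have h1 := hv.2 p hpA
      have h2 := hnonneg c hv.1.1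
      rw [inner_add_right, real_inner_smul_right] at h1
      have h3 : c = 0 := by nlinarith
      simp [h3]
    · rw [hε]
      refine ⟨hpA, fun v hv => ?_⟩
      obtain ⟨c, rfl⟩ := hline v hv
      have h2 := hnonneg c hv.1
      rw [inner_add_right, real_inner_smul_right]
      nlinarith
  · exfalso
    have hzero : ∀ u ∈ W, inner ℝ u (q - p) = 0 := by
      intro u huW
      push Not at hu
      have h1 := hu u huW
      have h2 := hu (-u) (W.neg_mem huW)
      rw [inner_neg_left] at h2
      linarith
    obtain ⟨u, huW, huw⟩ : ∃ u ∈ W, u ∉ Submodule.span ℝ {w} := by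
      by_contra! h
      have h1 := Submodule.finrank_mono (fun x hx => h x hx : W ≤ Submodule.span ℝ {w})
      rw [finrank_span_singleton hw0] at h1
      omega
    have hu0 : u ≠ 0 := by rintro rfl; exact huw (Submodule.zero_mem _)
    obtain ⟨r, hr, hur⟩ : ∃ r ∈ V, inner ℝ u r ≠ inner ℝ u p := by
      by_contra! h
      have := inner_eq_zero_of_mem_vectorSpan (fun a ha b hb => (h a ha).trans (h b hb).symm)
        (hspan ▸ Submodule.mem_top : u ∈ vectorSpan ℝ V)
      exact hu0 (by simpa using this)
    obtain ⟨t, ht⟩ := exists_argmaxSet_ssubset hV (l := w) (m := u) (fun x hx => by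
      obtain ⟨c, rfl⟩ := hline x hx
      rw [inner_add_right, real_inner_smul_right, hzero u huW, mul_zero, add_zero]) hpA hr hur
    have hne : w + t • u ≠ 0 := by
      intro h
      rcases eq_or_ne t 0 with rfl | ht0
      · exact hw0 (by simpa using h)
      · refine huw (Submodule.mem_span_singleton.2 ⟨-t⁻¹, ?_⟩)
        rw [eq_neg_of_add_eq_zero_left h, smul_neg, neg_smul, neg_neg, inv_smul_smul₀ ht0]
    obtain ⟨s, hs, hsA⟩ := Set.exists_of_ssubset ht
    have hlt := Submodule.finrank_lt_finrank_of_lt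
      (vectorSpan_lt_of_ssubset_argmaxSet subset_rfl hpA hs.1 hsA ht.subset hs)
    have := hface _ (W.add_mem hw (W.smul_mem t huW)) hne
    omega

end Dichotomy

/-! ### Vertices of the projection -/

section Projection

variable {d : ℕ} {W : Submodule ℝ (EuclideanSpace ℝ (Fin d))}
  {P V : Set (EuclideanSpace ℝ (Fin d))}

theorem convex_projOn (hP : Convex ℝ P) : Convex ℝ (projOn W P) :=
  hP.linear_image W.orthogonalProjectionOnto.toLinearMap

theorem isPolytope_projOn (hP : IsPolytope P) : IsPolytope (projOn W P) := by
  obtain ⟨s, hs, rfl⟩ := hP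
  exact ⟨projOn W s, hs.image _, LinearMap.image_convexHull W.orthogonalProjectionOnto.toLinearMap s⟩

theorem interior_projOn_nonempty (hP : (interior P).Nonempty) :
    (interior (projOn W P)).Nonempty := by
  have hopen : IsOpenMap W.orthogonalProjectionOnto :=
    W.orthogonalProjectionOnto.isOpenMap fun x => ⟨x, by simp⟩
  exact (hP.image W.orthogonalProjectionOnto).mono (hopen.image_interior_subset P)

/-- The projection restricts to a bijection from the strictly exposed points of `V` onto the vertices
of the projected polytope. -/
theorem encard_extremePoints_projOn (hV : V.Finite)
    (hint : (interior (projOn W (convexHull ℝ V))).Nonempty) (hW : W ≠ ⊥)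
    (hdich : ∀ p ∈ V, IsStrictlyExposedIn W V p ∨ IsInnerIn W V p) :
    ((projOn W (convexHull ℝ V)).extremePoints ℝ).encard =
      {p ∈ V | IsStrictlyExposedIn W V p}.encard := by
  have hinj : Set.InjOn W.orthogonalProjectionOnto {p ∈ V | IsStrictlyExposedIn W V p} := by
    rintro p ⟨-, w, hw, hwp⟩ q ⟨hqV, -⟩ hpq
    by_contra hne
    have h1 := hwp q hqV (Ne.symm hne)
    have h2 := congrArg (inner ℝ (⟨w, hw⟩ : W)) hpq
    rw [Submodule.inner_orthogonalProjectionOnto_eq_of_mem_left,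
      Submodule.inner_orthogonalProjectionOnto_eq_of_mem_left] at h2
    exact h1.ne' h2
  rw [← hinj.encard_image]
  congr 1
  refine Set.Subset.antisymm (fun y hy => ?_) ?_
  · have hyV : y ∈ W.orthogonalProjectionOnto '' V := by
      have h : projOn W (convexHull ℝ V) = convexHull ℝ (W.orthogonalProjectionOnto '' V) :=
        LinearMap.image_convexHull W.orthogonalProjectionOnto.toLinearMap V
      rw [h] at hy
      exact extremePoints_convexHull_subset hy
    obtain ⟨p, hpV, rfl⟩ := hyV
    refine ⟨p, ⟨hpV, (hdich p hpV).resolve_right fun hin => ?_⟩, rfl⟩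
    have : Nontrivial W := Submodule.nontrivial_iff_ne_bot.2 hW
    have hnot : W.orthogonalProjectionOnto p ∉ interior (projOn W (convexHull ℝ V)) := fun h =>
      Set.disjoint_left.1 (disjoint_interior_extremePoints _) h hy
    obtain ⟨w, hw0, hw⟩ := (convex_projOn (convex_convexHull ℝ V)).exists_inner_le_of_disjoint_interior
      hint (convex_singleton (W.orthogonalProjectionOnto p)) (Set.singleton_nonempty _)
      (Set.disjoint_singleton_right.2 hnot)
    obtain ⟨v, hv, hlt⟩ := hin w w.2 (by simpa using hw0)
    have := hw _ ⟨v, subset_convexHull ℝ V hv, rfl⟩ _ rfl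
    rw [Submodule.inner_orthogonalProjectionOnto_eq_of_mem_left,
      Submodule.inner_orthogonalProjectionOnto_eq_of_mem_left] at this
    exact absurd this (not_le.2 hlt)
  · rintro _ ⟨p, ⟨hpV, w, hw, hwp⟩, rfl⟩
    refine exposedPoints_subset_extremePoints (𝕜 := ℝ)
      ⟨⟨p, subset_convexHull ℝ V hpV, rfl⟩, innerSL ℝ (⟨w, hw⟩ : W), ?_⟩
    rintro _ ⟨x, hx, rfl⟩
    simp only [innerSL_apply_apply, Submodule.inner_orthogonalProjectionOnto_eq_of_mem_left]
    have hle : ∀ v ∈ V, inner ℝ w v ≤ inner ℝ w p := fun v hv => by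
      rcases eq_or_ne v p with rfl | hne
      exacts [le_rfl, (hwp v hv hne).le]
    refine ⟨inner_le_of_mem_convexHull hle hx, fun h => ?_⟩
    have hxF : x ∈ (innerSL ℝ w).toExposed (convexHull ℝ V) :=
      ⟨hx, fun y hy => (inner_le_of_mem_convexHull hle hy).trans h⟩
    have harg : argmaxSet V w ⊆ {p} := fun v hv => by
      by_contra hne
      exact absurd (hv.2 p hpV) (not_le.2 (hwp v hv.1 hne))
    rw [toExposed_convexHull hV] at hxF
    have := convexHull_mono harg hxF
    rw [convexHull_singleton] at this
    rw [Set.mem_singleton_iff.1 this]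

/-- The faces exposed by functionals of a plane admissible for the boundary notion are vertices or
edges: they are sent into the boundary of the projection. -/
theorem BoundaryAdmissible.finrank_vectorSpan_argmaxSet_lt (hV : V.Finite)
    (hW : BoundaryAdmissible (convexHull ℝ V) W) {w : EuclideanSpace ℝ (Fin d)} (hw : w ∈ W)
    (hw0 : w ≠ 0) : finrank ℝ (vectorSpan ℝ (argmaxSet V w)) < 2 := by
  by_contra! h
  obtain ⟨m, hm, h2⟩ := exists_argmaxSet_subset_finrank_eq_two hV w h
  refine hW.2 ((innerSL ℝ m).toExposed (convexHull ℝ V))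
    ⟨ContinuousLinearMap.toExposed.isExposed, ?_⟩ ?_
  · rw [toExposed_convexHull hV, vectorSpan_convexHull, h2]
  · rintro _ ⟨x, hx, rfl⟩
    have hxw : x ∈ (innerSL ℝ w).toExposed (convexHull ℝ V) := by
      rw [toExposed_convexHull hV] at hx ⊢
      exact convexHull_mono hm hx
    refine mem_frontier_of_forall_inner_le (w := (⟨w, hw⟩ : W)) (by simpa using hw0)
      ⟨x, hx.1, rfl⟩ ?_
    rintro _ ⟨z, hz, rfl⟩
    rw [Submodule.inner_orthogonalProjectionOnto_eq_of_mem_left,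
      Submodule.inner_orthogonalProjectionOnto_eq_of_mem_left]
    exact hxw.2 z hz

end Projection

/-! ### Perturbation of planes -/

section Perturbation

variable {E : Type*} [NormedAddCommGroup E] [InnerProductSpace ℝ E]

theorem IsStrictlyExposedIn.eventually {V : Set E} (hV : V.Finite) {w₁ w₂ p : E}
    (h : IsStrictlyExposedIn (Submodule.span ℝ {w₁, w₂}) V p) :
    ∀ᶠ z : E × E in nhds (w₁, w₂), IsStrictlyExposedIn (Submodule.span ℝ {z.1, z.2}) V p := by
  obtain ⟨w, hw, hwp⟩ := h
  obtain ⟨a, b, rfl⟩ := Submodule.mem_span_pair.1 hw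
  have key : ∀ᶠ z : E × E in nhds (w₁, w₂), ∀ v ∈ V, v ≠ p →
      inner ℝ (a • z.1 + b • z.2) v < inner ℝ (a • z.1 + b • z.2) p := by
    refine (Filter.eventually_all_finite hV).2 fun v hv => ?_
    rcases eq_or_ne v p with rfl | hne
    · exact Filter.Eventually.of_forall fun _ h => absurd rfl h
    have hc : ∀ x : E, Continuous fun z : E × E => (inner ℝ (a • z.1 + b • z.2) x : ℝ) :=
      fun x => by fun_prop
    filter_upwards [(hc v).continuousAt.eventually_lt (hc p).continuousAt (hwp v hv hne)]
      with z hz _ using hz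
  filter_upwards [key] with z hz
  exact ⟨_, Submodule.mem_span_pair.2 ⟨a, b, rfl⟩, hz⟩

/-- Being inner is an open condition on the spanning pair of a plane: by homogeneity it involves only
the coefficients in the unit sphere, which is compact. -/
theorem IsInnerIn.eventually {V : Set E} {w₁ w₂ p : E}
    (hind : ∀ a b : ℝ, a • w₁ + b • w₂ = 0 → a = 0 ∧ b = 0)
    (h : IsInnerIn (Submodule.span ℝ {w₁, w₂}) V p) :
    ∀ᶠ z : E × E in nhds (w₁, w₂), IsInnerIn (Submodule.span ℝ {z.1, z.2}) V p := by
  have key : ∀ᶠ z : E × E in nhds (w₁, w₂), ∀ c ∈ Metric.sphere (0 : ℝ × ℝ) 1,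
      ∃ v ∈ V, inner ℝ (c.1 • z.1 + c.2 • z.2) p < inner ℝ (c.1 • z.1 + c.2 • z.2) v := by
    refine (isCompact_sphere (0 : ℝ × ℝ) 1).eventually_forall_of_forall_eventually fun c hc => ?_
    have hc0 : c ≠ 0 := ne_zero_of_mem_unit_sphere ⟨c, hc⟩
    obtain ⟨v, hv, hlt⟩ := h (c.1 • w₁ + c.2 • w₂) (Submodule.mem_span_pair.2 ⟨_, _, rfl⟩)
      fun h0 => hc0 (Prod.ext (hind _ _ h0).1 (hind _ _ h0).2)
    have hcont : ∀ x : E, Continuous fun y : (E × E) × (ℝ × ℝ) =>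
        (inner ℝ (y.2.1 • y.1.1 + y.2.2 • y.1.2) x : ℝ) := fun x => by fun_prop
    filter_upwards [(hcont p).continuousAt.eventually_lt (hcont v).continuousAt hlt] with y hy
    exact ⟨v, hv, hy⟩
  filter_upwards [key] with z hz w hw hw0
  obtain ⟨a, b, rfl⟩ := Submodule.mem_span_pair.1 hw
  have hab : (a, b) ≠ (0 : ℝ × ℝ) := by
    intro h0
    obtain ⟨rfl, rfl⟩ := Prod.ext_iff.1 h0
    simp at hw0
  have hpos : 0 < ‖(a, b)‖ := norm_pos_iff.2 hab
  obtain ⟨v, hv, hlt⟩ := hz (‖(a, b)‖⁻¹ • (a, b)) (by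
    rw [mem_sphere_zero_iff_norm, norm_smul, norm_inv, norm_norm, inv_mul_cancel₀ hpos.ne'])
  refine ⟨v, hv, ?_⟩
  have e : (‖(a, b)‖⁻¹ • (a, b)).1 • z.1 + (‖(a, b)‖⁻¹ • (a, b)).2 • z.2 =
      ‖(a, b)‖⁻¹ • (a • z.1 + b • z.2) := by
    simp [smul_add, smul_smul]
  rw [e, real_inner_smul_left, real_inner_smul_left] at hlt
  exact lt_of_mul_lt_mul_left hlt (inv_pos.2 hpos).le

theorem dense_compl_of_ne_top [FiniteDimensional ℝ E] {K : Submodule ℝ E} (hK : K ≠ ⊤) :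
    Dense (K : Set E)ᶜ := by
  rw [← interior_eq_empty_iff_dense_compl, ← Set.not_nonempty_iff_eq_empty]
  exact fun h => hK (K.eq_top_of_nonempty_interior' h)

theorem exists_mem_nhds_forall_notMem [FiniteDimensional ℝ E] {𝒦 : Set (Submodule ℝ E)}
    (h𝒦 : 𝒦.Finite) (hne : ∀ K ∈ 𝒦, K ≠ ⊤) {w : E} {U : Set E} (hU : U ∈ nhds w) :
    ∃ z ∈ U, ∀ K ∈ 𝒦, z ∉ K := by
  have hd : Dense (⋂ K ∈ 𝒦, (K : Set E)ᶜ) := dense_biInter_of_isOpen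
    (fun K _ => K.closed_of_finiteDimensional.isOpen_compl) h𝒦.countable
    fun K hK => dense_compl_of_ne_top (hne K hK)
  obtain ⟨z, hzU, hz⟩ := mem_closure_iff_nhds.1 (hd w) U hU
  exact ⟨z, hzU, by simpa using hz⟩

/-- Close to any pair of vectors, there is one whose span projects injectively all the planes of a
given finite family. -/
theorem exists_mem_nhds_forall_injOn [FiniteDimensional ℝ E] {𝒟 : Set (Submodule ℝ E)}
    (h𝒟 : 𝒟.Finite) (h2 : ∀ D ∈ 𝒟, finrank ℝ D = 2) {w₁ w₂ : E} {U : Set (E × E)}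
    (hU : U ∈ nhds (w₁, w₂)) :
    ∃ z ∈ U, ∀ D ∈ 𝒟, ∀ x ∈ D, inner ℝ z.1 x = 0 → inner ℝ z.2 x = 0 → x = 0 := by
  obtain ⟨U₁, hU₁, U₂, hU₂, hsub⟩ := mem_nhds_prod_iff.1 hU
  have hne : ∀ K : Submodule ℝ E, K ≠ ⊥ → Kᗮ ≠ ⊤ := fun K hK h =>
    hK ((Submodule.orthogonal_eq_top_iff K).1 h)
  obtain ⟨z₁, hz₁U, hz₁⟩ := exists_mem_nhds_forall_notMem (𝒦 := (fun D => Dᗮ) '' 𝒟)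
    (h𝒟.image _) (by
      rintro _ ⟨D, hD, rfl⟩
      refine hne D ?_
      rintro rfl
      simpa using h2 _ hD) hU₁
  -- With `z₁` not orthogonal to `D`, the vectors of `D` orthogonal to `z₁` form at most a line `N D`.
  let N : Submodule ℝ E → Submodule ℝ E := fun D => D ⊓ (Submodule.span ℝ {z₁})ᗮ
  obtain ⟨z₂, hz₂U, hz₂⟩ := exists_mem_nhds_forall_notMem
    (𝒦 := (fun D => (N D)ᗮ) '' {D ∈ 𝒟 | N D ≠ ⊥}) ((h𝒟.subset fun _ h => h.1).image _) (by
      rintro _ ⟨D, hD, rfl⟩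
      exact hne _ hD.2) hU₂
  refine ⟨(z₁, z₂), hsub ⟨hz₁U, hz₂U⟩, fun D hD x hx h1 h2x => ?_⟩
  by_contra hx0
  have hxN : x ∈ N D := ⟨hx, Submodule.mem_orthogonal_singleton_iff_inner_right.2 h1⟩
  have hND : N D ≠ ⊥ := (Submodule.ne_bot_iff _).2 ⟨x, hxN, hx0⟩
  have hlt : N D < D := by
    refine lt_of_le_of_ne inf_le_left fun he => hz₁ _ ⟨D, hD, rfl⟩ ?_
    refine (Submodule.mem_orthogonal' D z₁).2 fun y hy => ?_
    rw [← he] at hy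
    exact Submodule.mem_orthogonal_singleton_iff_inner_right.1 hy.2
  have hone : finrank ℝ (N D) = 1 := by
    have h3 := Submodule.finrank_lt_finrank_of_lt hlt
    have h4 := Submodule.one_le_finrank_iff.2 hND
    rw [h2 D hD] at h3
    omega
  refine hz₂ _ ⟨D, ⟨hD, hND⟩, rfl⟩ ((Submodule.mem_orthogonal' (N D) z₂).2 fun y hy => ?_)
  obtain ⟨c, hc⟩ := (finrank_eq_one_iff_of_nonzero' (⟨x, hxN⟩ : N D) (by simpa using hx0)).1 hone
    ⟨y, hy⟩
  have : c • x = y := congrArg Subtype.val hc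
  rw [← this, real_inner_smul_right, h2x, mul_zero]

end Perturbation

/-! ### Comparison of the two notions of admissibility -/

section Comparison

theorem exists_eq_segment_of_sub_mem_span {E : Type*} [NormedAddCommGroup E]
    [InnerProductSpace ℝ E] {T : Set E} (hT : IsCompact T) (hTc : Convex ℝ T)
    (hne : T.Nonempty) {u : E} (hu : u ≠ 0)
    (h : ∀ x ∈ T, ∀ y ∈ T, x - y ∈ Submodule.span ℝ {u}) :
    ∃ a b : E, T = segment ℝ a b := by
  have hcont : ContinuousOn (fun x : E => (inner ℝ u x : ℝ)) T := by fun_prop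
  obtain ⟨a, ha, hmin⟩ := hT.exists_isMinOn hne hcont
  obtain ⟨b, hb, hmax⟩ := hT.exists_isMaxOn hne hcont
  refine ⟨a, b, Set.Subset.antisymm (fun x hx => ?_) (hTc.segment_subset ha hb)⟩
  obtain ⟨c, hc⟩ := Submodule.mem_span_singleton.1 (h x hx a ha)
  obtain ⟨c', hc'⟩ := Submodule.mem_span_singleton.1 (h b hb a ha)
  have hux : inner ℝ u x = inner ℝ u a + c * inner ℝ u u := by
    rw [← real_inner_smul_right, hc, inner_sub_right]; ring
  have hub : inner ℝ u b = inner ℝ u a + c' * inner ℝ u u := by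
    rw [← real_inner_smul_right, hc', inner_sub_right]; ring
  have huu : 0 < inner ℝ u u := real_inner_self_pos.2 hu
  have h1 : inner ℝ u a ≤ inner ℝ u x := hmin hx
  have h2 : inner ℝ u x ≤ inner ℝ u b := hmax hx
  have h0c : 0 ≤ c := by nlinarith
  have hcc' : c ≤ c' := by nlinarith
  rw [segment_eq_image']
  refine ⟨c / c', ⟨div_nonneg h0c (h0c.trans hcc'), div_le_one_of_le₀ hcc' (h0c.trans hcc')⟩, ?_⟩
  have h3 : c / c' * c' = c := by
    rcases eq_or_ne c' 0 with h0 | h0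
    · have : c = 0 := by linarith
      simp [this]
    · exact div_mul_cancel₀ _ h0
  simp only [← hc', smul_smul, h3, hc]
  abel

variable {d : ℕ} {P : Set (EuclideanSpace ℝ (Fin d))} {W : Submodule ℝ (EuclideanSpace ℝ (Fin d))}

/-- A `2`-face sent into the boundary of the projection is sent into a supporting line, hence onto a
segment. -/
theorem SegmentAdmissible.boundaryAdmissible (hP : IsPolytope P) (hPi : (interior P).Nonempty)
    (hW : SegmentAdmissible P W) : BoundaryAdmissible P W := by
  refine ⟨hW.1, fun F hF hsub => hW.2 F hF ?_⟩
  obtain ⟨s, hs, rfl⟩ := hP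
  have hFne : F.Nonempty := by
    rw [Set.nonempty_iff_ne_empty]
    rintro rfl
    have h := hF.2
    rw [vectorSpan_empty, finrank_bot] at h
    omega
  have hT : IsCompact (projOn W F) :=
    (hF.1.isCompact (hs.isCompact_convexHull ℝ)).image W.orthogonalProjectionOnto.continuous
  have hTc : Convex ℝ (projOn W F) := convex_projOn (hF.1.convex (convex_convexHull ℝ s))
  have hTne : (projOn W F).Nonempty := hFne.image _
  obtain ⟨w, hw0, hw⟩ :=
    (convex_projOn (W := W) (convex_convexHull ℝ s)).exists_inner_le_of_disjoint_interior
      (interior_projOn_nonempty hPi) hTc hTne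
      (Set.disjoint_right.2 fun y hy hyi => (hsub hy).2 hyi)
  have hTS : projOn W F ⊆ projOn W (convexHull ℝ s) := Set.image_mono hF.1.subset
  have hone : finrank ℝ (Submodule.span ℝ {w})ᗮ = 1 := by
    have h1 := (Submodule.span ℝ {w}).finrank_add_finrank_orthogonal
    rw [finrank_span_singleton hw0, hW.1] at h1
    omega
  obtain ⟨u, hu0, hu⟩ := finrank_eq_one_iff'.1 hone
  refine exists_eq_segment_of_sub_mem_span hT hTc hTne (u := (u : W)) (by simpa using hu0)
    fun x hx y hy => ?_
  have hxy : x - y ∈ (Submodule.span ℝ {w})ᗮ := by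
    rw [Submodule.mem_orthogonal_singleton_iff_inner_right, inner_sub_right, sub_eq_zero]
    exact le_antisymm (hw x (hTS hx) y hy) (hw y (hTS hy) x hx)
  obtain ⟨c, hc⟩ := hu ⟨x - y, hxy⟩
  exact Submodule.mem_span_singleton.2 ⟨c, congrArg Subtype.val hc⟩

theorem segmentAdmissible_of_injective (hW : finrank ℝ W = 2)
    (h : ∀ F, IsTwoFace P F → ∀ x ∈ vectorSpan ℝ F, W.orthogonalProjectionOnto x = 0 → x = 0) :
    SegmentAdmissible P W := by
  refine ⟨hW, fun F hF => ?_⟩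
  rintro ⟨a, b, hab⟩
  let π : EuclideanSpace ℝ (Fin d) →ₗ[ℝ] W := W.orthogonalProjectionOnto.toLinearMap
  have hmap : (vectorSpan ℝ F).map π = vectorSpan ℝ (projOn W F) :=
    π.toAffineMap.map_vectorSpan
  have hinj : Function.Injective (π.domRestrict (vectorSpan ℝ F)) := by
    rw [← LinearMap.ker_eq_bot, LinearMap.ker_eq_bot']
    intro x hx
    exact Subtype.ext (h F hF x x.2 hx)
  have h1 := LinearMap.finrank_range_of_inj hinj
  rw [LinearMap.range_domRestrict, hmap, hab, vectorSpan_segment, hF.2] at h1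
  have h2 := finrank_span_le_card (R := ℝ) ({b -ᵥ a} : Set W)
  simp only [Set.toFinset_singleton, Finset.card_singleton] at h2
  have h3 := h1.symm.le.trans h2
  omega

theorem finite_setOf_vectorSpan_isTwoFace {V : Set (EuclideanSpace ℝ (Fin d))} (hV : V.Finite) :
    {D : Submodule ℝ _ | ∃ F, IsTwoFace (convexHull ℝ V) F ∧ D = vectorSpan ℝ F}.Finite := by
  refine (hV.finite_subsets.image (vectorSpan ℝ)).subset ?_
  rintro _ ⟨F, hF, rfl⟩
  refine ⟨F ∩ V, Set.inter_subset_right, ?_⟩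
  rw [← vectorSpan_convexHull, ← hF.1.eq_convexHull_inter hV]

/-- A plane admissible for the boundary notion has, arbitrarily close to it, a plane admissible for
the segment notion on which the projection has the same number of vertices. -/
theorem BoundaryAdmissible.exists_segmentAdmissible {V : Set (EuclideanSpace ℝ (Fin d))}
    (hV : V.Finite) (hVext : V ⊆ (convexHull ℝ V).extremePoints ℝ)
    (hPi : (interior (convexHull ℝ V)).Nonempty)
    (hW : BoundaryAdmissible (convexHull ℝ V) W) :
    ∃ W', SegmentAdmissible (convexHull ℝ V) W' ∧
      ((projOn W' (convexHull ℝ V)).extremePoints ℝ).encard =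
        ((projOn W (convexHull ℝ V)).extremePoints ℝ).encard := by
  have hbot : ∀ W' : Submodule ℝ (EuclideanSpace ℝ (Fin d)), finrank ℝ W' = 2 → W' ≠ ⊥ := by
    rintro _ h rfl
    simp at h
  have hspan : vectorSpan ℝ V = ⊤ := by
    rw [← direction_affineSpan, interior_convexHull_nonempty_iff_affineSpan_eq_top.1 hPi,
      AffineSubspace.direction_top]
  have hdich : ∀ p ∈ V, IsStrictlyExposedIn W V p ∨ IsInnerIn W V p := fun p hp =>
    isStrictlyExposedIn_or_isInnerIn hV hW.1 hspan
      (fun w hw hw0 => hW.finrank_vectorSpan_argmaxSet_lt hV hw hw0) (hVext hp)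
  obtain ⟨w₁, w₂, hind, hWw⟩ : ∃ w₁ w₂ : EuclideanSpace ℝ (Fin d),
      (∀ a b : ℝ, a • w₁ + b • w₂ = 0 → a = 0 ∧ b = 0) ∧ W = Submodule.span ℝ {w₁, w₂} := by
    let b := finBasisOfFinrankEq ℝ W hW.1
    have hli : LinearIndependent ℝ ![(b 0 : EuclideanSpace ℝ (Fin d)), b 1] := by
      have h := b.linearIndependent.map' W.subtype W.ker_subtype
      have e : ![(b 0 : EuclideanSpace ℝ (Fin d)), b 1] = W.subtype ∘ b := by
        funext i
        fin_cases i <;> rfl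
      rw [e]
      exact h
    refine ⟨b 0, b 1, LinearIndependent.pair_iff.1 hli, ?_⟩
    refine (Submodule.eq_of_le_of_finrank_eq ?_ ?_).symm
    · rw [Submodule.span_le]
      rintro _ (rfl | rfl)
      exacts [(b 0).2, (b 1).2]
    · have h := finrank_span_eq_card hli
      rw [Matrix.range_cons, Matrix.range_cons, Matrix.range_empty, Set.union_empty,
        Set.singleton_union] at h
      rw [h, hW.1, Fintype.card_fin]
  have hnear : ∀ᶠ z : EuclideanSpace ℝ (Fin d) × EuclideanSpace ℝ (Fin d) in nhds (w₁, w₂),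
      ∀ p ∈ V, (IsStrictlyExposedIn W V p ∧
        IsStrictlyExposedIn (Submodule.span ℝ {z.1, z.2}) V p) ∨
        (IsInnerIn W V p ∧ IsInnerIn (Submodule.span ℝ {z.1, z.2}) V p) := by
    refine (Filter.eventually_all_finite hV).2 fun p hp => ?_
    rcases hdich p hp with h | h
    · filter_upwards [IsStrictlyExposedIn.eventually hV (hWw ▸ h)] with z hz using Or.inl ⟨h, hz⟩
    · filter_upwards [IsInnerIn.eventually hind (hWw ▸ h)] with z hz using Or.inr ⟨h, hz⟩
  -- The plane `W` joins the family so that the perturbed pair spans a plane.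
  obtain ⟨z, hz, hsep⟩ := exists_mem_nhds_forall_injOn
    ((finite_setOf_vectorSpan_isTwoFace hV).insert W) (by
      rintro _ (rfl | ⟨F, hF, rfl⟩)
      exacts [hW.1, hF.2]) hnear
  set W' := Submodule.span ℝ {z.1, z.2} with hW'def
  have hinj : ∀ D ∈ insert W {D : Submodule ℝ _ | ∃ F, IsTwoFace (convexHull ℝ V) F ∧
      D = vectorSpan ℝ F}, ∀ x ∈ D, W'.orthogonalProjectionOnto x = 0 → x = 0 := by
    intro D hD x hx hx0
    rw [Submodule.orthogonalProjectionOnto_eq_zero_iff, Submodule.mem_orthogonal] at hx0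
    exact hsep D hD x hx (hx0 _ (Submodule.subset_span (by simp)))
      (hx0 _ (Submodule.subset_span (by simp)))
  have hW' : finrank ℝ W' = 2 := by
    refine le_antisymm ?_ ?_
    · have h := finrank_span_le_card (R := ℝ) (({z.1, z.2} : Set (EuclideanSpace ℝ (Fin d))))
      refine h.trans ?_
      rw [← Set.ncard_eq_toFinset_card']
      exact (Set.ncard_insert_le _ _).trans (by rw [Set.ncard_singleton])
    · rw [← hW.1]
      refine LinearMap.finrank_le_finrank_of_injective
        (f := W'.orthogonalProjectionOnto.toLinearMap.domRestrict W) ?_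
      rw [← LinearMap.ker_eq_bot, LinearMap.ker_eq_bot']
      intro x hx
      exact Subtype.ext (hinj W (Set.mem_insert _ _) x x.2 hx)
  refine ⟨W', segmentAdmissible_of_injective hW' fun F hF =>
    hinj _ (Set.mem_insert_of_mem _ ⟨F, hF, rfl⟩), ?_⟩
  rw [encard_extremePoints_projOn hV (interior_projOn_nonempty hPi) (hbot W hW.1) hdich,
    encard_extremePoints_projOn hV (interior_projOn_nonempty hPi) (hbot W' hW')
      fun p hp => (hz p hp).imp And.right And.right]
  congr 1
  ext p
  refine and_congr_right fun hp => ?_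
  rcases hz p hp with h | h
  · exact iff_of_true h.2 h.1
  · exact iff_of_false (h.2.not_isStrictlyExposedIn (hbot W' hW'))
      (h.1.not_isStrictlyExposedIn (hbot W hW.1))

theorem isKEquiprojective_boundaryAdmissible_iff (hP : IsPolytope P)
    (hPi : (interior P).Nonempty) (k : ℕ) :
    IsKEquiprojective BoundaryAdmissible k P ↔ IsKEquiprojective SegmentAdmissible k P := by
  refine ⟨fun h W hW => h W (hW.boundaryAdmissible hP hPi), fun h W hW =>
    ⟨isPolytope_projOn hP, interior_projOn_nonempty hPi, ?_⟩⟩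
  obtain ⟨V, hV, hVext, rfl⟩ : ∃ V : Set (EuclideanSpace ℝ (Fin d)), V.Finite ∧
      V ⊆ (convexHull ℝ V).extremePoints ℝ ∧ P = convexHull ℝ V := by
    obtain ⟨s, hs, rfl⟩ := hP
    have hfin : ((convexHull ℝ s).extremePoints ℝ).Finite :=
      hs.subset extremePoints_convexHull_subset
    have heq : convexHull ℝ ((convexHull ℝ s).extremePoints ℝ) = convexHull ℝ s := by
      rw [← (hfin.isCompact_convexHull ℝ).isClosed.closure_eq,
        closure_convexHull_extremePoints (hs.isCompact_convexHull ℝ) (convex_convexHull ℝ s)]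
    exact ⟨_, hfin, by rw [heq], heq.symm⟩
  obtain ⟨W', hW', hcard⟩ := hW.exists_segmentAdmissible hV hVext hPi
  rw [← hcard]
  exact (h W' hW').2.2

end Comparison

theorem mainTheorem5 (d : ℕ) (P : Set (EuclideanSpace ℝ (Fin d))) (hP : IsPolytope P)
    (hfull : affineSpan ℝ P = ⊤) :
    (∀ k : ℕ, IsKEquiprojective BoundaryAdmissible k P ↔
      IsKEquiprojective SegmentAdmissible k P) ∧
    (IsEquiprojective BoundaryAdmissible P ↔ IsEquiprojective SegmentAdmissible P) := by
  have hconv : Convex ℝ P := by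
    obtain ⟨s, -, rfl⟩ := hP
    exact convex_convexHull ℝ s
  have hPi : (interior P).Nonempty := hconv.interior_nonempty_iff_affineSpan_eq_top.2 hfull
  have h := isKEquiprojective_boundaryAdmissible_iff hP hPi
  exact ⟨h, exists_congr h⟩
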